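/- Let $p:[0,1]\to\mathbb R$ be piecewise continuous (continuous at all but finitely many points, with finite one-sided limits everywhere), positive and bounded away from $0$, and let $\alpha\in(0,\pi]$, $\beta\in[0,\pi)$. Let $S(p,\alpha,\beta)$ be the string operator generated by the boundary value problem $$-u''=\lambda\,p(x)\,u\quad (0<x<1),\qquad u(0)\cos\alpha+u'(0)\sin\alpha=0,\qquad u(1)\cos\beta+u'(1)\sin\beta=0,\qquad \lambda\in\mathbb C,$$ where solutions $u$ are continuously differentiable on $[0,1]$ and satisfy the equation at the points of continuity of $p$. All eigenvalues of $S(p,\alpha,\beta)$ are real and there is a lowest one, denoted $\lambda_0(p,\alpha,\beta)$; in particular $\lambda_0(1,\alpha,\beta)$ is the lowest eigenvalue for the constant density $1$. Put $m=\inf_{x\in[0,1]}p(x)^{-1}$ and $M=\sup_{x\in[0,1]}p(x)^{-1}$ (the minimum and maximum of $p^{-1}$ when these are attained). Then $\lambda_0(p,\alpha,\beta)$ lies between $\lambda_0(1,\alpha,\beta)\,m$ and $\lambda_0(1,\alpha,\beta)\,M$. That is, if $\lambda_0(1,\alpha,\beta)\ge 0$, then $$\lambda_0(1,\alpha,\beta)\,m\;\le\;\lambda_0(p,\alpha,\beta)\;\le\;\lambda_0(1,\alpha,\beta)\,M,$$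 and if $\lambda_0(1,\alpha,\beta)\le 0$, then $$\lambda_0(1,\alpha,\beta)\,M\;\le\;\lambda_0(p,\alpha,\beta)\;\le\;\lambda_0(1,\alpha,\beta)\,m.$$ -/

import Mathlib

open Set Filter Topology

/-- `p` is piecewise continuous on `[0, 1]`: it is continuous at all but finitely many points of
`(0, 1)` and has finite one-sided limits at every point of `[0, 1]`. -/
def PiecewiseContinuous (p : ℝ → ℝ) : Prop :=
  {x ∈ Ioo (0 : ℝ) 1 | ¬ ContinuousAt p x}.Finite ∧
  (∀ x ∈ Ico (0 : ℝ) 1, ∃ L : ℝ, Tendsto p (𝓝[>] x) (𝓝 L)) ∧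
  (∀ x ∈ Ioc (0 : ℝ) 1, ∃ L : ℝ, Tendsto p (𝓝[<] x) (𝓝 L))

/-- Density functions of a string: real-valued functions on `[0, 1]` that are piecewise continuous,
positive and bounded away from `0`. Values of `p` outside `[0, 1]` play no role. -/
structure IsDensity (p : ℝ → ℝ) : Prop where
  piecewiseContinuous : PiecewiseContinuous p
  bounded_away : ∃ c : ℝ, 0 < c ∧ ∀ x ∈ Icc (0 : ℝ) 1, c ≤ p x

/-- `u` (with derivative `u'`) is an eigenfunction, for the spectral parameter `μ`, of the problem
`-u'' = μ p u` on `(0, 1)`, `u(0) cos α + u'(0) sin α = 0`, `u(1) cos β + u'(1) sin β = 0`.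
As usual for a piecewise continuous density, `u` is continuously differentiable on `[0, 1]` and the
differential equation holds at the points of continuity of `p`; for such `p` this is the same as
`u'` being absolutely continuous with the equation holding almost everywhere. -/
structure IsEigenfunction (p : ℝ → ℝ) (α β : ℝ) (μ : ℂ) (u u' : ℝ → ℂ) : Prop where
  hasDeriv : ∀ x ∈ Icc (0 : ℝ) 1, HasDerivWithinAt u (u' x) (Icc 0 1) x
  continuousOn_deriv : ContinuousOn u' (Icc 0 1)
  equation : ∀ x ∈ Ioo (0 : ℝ) 1, ContinuousAt p x → HasDerivAt u' (-(μ * (p x : ℂ) * u x)) x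
  boundary_zero : u 0 * (Real.cos α : ℂ) + u' 0 * (Real.sin α : ℂ) = 0
  boundary_one : u 1 * (Real.cos β : ℂ) + u' 1 * (Real.sin β : ℂ) = 0
  nonzero : ∃ x ∈ Icc (0 : ℝ) 1, u x ≠ 0

/-- `μ` is an eigenvalue of the string operator `S(p, α, β)`. -/
def IsStringEigenvalue (p : ℝ → ℝ) (α β : ℝ) (μ : ℂ) : Prop :=
  ∃ u u' : ℝ → ℂ, IsEigenfunction p α β μ u u'

/-- The real number `l` is the lowest eigenvalue of `S(p, α, β)`: it is an eigenvalue, and every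
eigenvalue is real and at least `l`. -/
def IsLowestEigenvalue (p : ℝ → ℝ) (α β l : ℝ) : Prop :=
  IsStringEigenvalue p α β (l : ℂ) ∧
  ∀ μ : ℂ, IsStringEigenvalue p α β μ → μ.im = 0 ∧ l ≤ μ.re

/-- The number `λ₀(p, α, β)`, the infimum of the real eigenvalues of `S(p, α, β)`. -/
noncomputable def lowestEigenvalue (p : ℝ → ℝ) (α β : ℝ) : ℝ :=
  sInf {l : ℝ | IsStringEigenvalue p α β (l : ℂ)}

/-- The infimum of `1 / p` over `[0, 1]` (the minimum whenever it is attained). -/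
noncomputable def infInv (p : ℝ → ℝ) : ℝ := sInf ((fun x => (p x)⁻¹) '' Icc (0 : ℝ) 1)

/-- The supremum of `1 / p` over `[0, 1]` (the maximum whenever it is attained). -/
noncomputable def supInv (p : ℝ → ℝ) : ℝ := sSup ((fun x => (p x)⁻¹) '' Icc (0 : ℝ) 1)

/-!
For every real parameter `l`, the initial value problem with data satisfying the boundary condition
at `0` has a unique solution `u l`, an entire power series in `l`. Normalised to start out positive,
it stays positive when `l` is very negative, by comparison with an explicit positive subsolution,
and it cannot stay positive once `l` is large. At the supremum of the parameters for which `u l` is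
positive and the boundary expression at `1` is positive too, the solution is still positive on
`(0, 1)` and satisfies the boundary condition at `1`: it is a positive eigenfunction.

Picone's identity
`(v v' - v² u' / u)' = (v' - v u' / u)² + (l p - m q) v²` for `-u'' = l p u` and `-v'' = m q v`
shows that, if `u > 0` and both functions satisfy the boundary conditions, then `m q < l p` cannot
hold on all of `(0, 1)`, because the flux vanishes at both ends. With `q = p` this makes the
eigenvalue of a positive eigenfunction the lowest one; with two different densities it gives points
`x` at which `λ₀(p)` lies on either side of `λ₀(q) q(x) / p(x)`.
-/

open MeasureTheory

/-! ### Monotonicity off a countable set -/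

section OffCountable

variable {a b : ℝ} {f f' : ℝ → ℝ} {S : Set ℝ}

theorem le_of_hasDerivAt_pos_off_countable (hS : S.Countable) (hab : a ≤ b)
    (hf : ContinuousOn f (Icc a b)) (hd : ∀ x ∈ Ioo a b, x ∉ S → HasDerivAt f (f' x) x)
    (hpos : ∀ x ∈ Ioo a b, x ∉ S → 0 < f' x) : f a ≤ f b := by
  by_contra! hlt
  -- At the last point where `f` takes a value `y ∉ f '' S`, the derivative cannot be positive.
  obtain ⟨y, hyS, hy⟩ :=
    ((hS.image f).dense_compl ℝ).exists_mem_open isOpen_Ioo (nonempty_Ioo.2 hlt)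
  have hcompact : IsCompact (Icc a b ∩ f ⁻¹' Ici y) :=
    isCompact_Icc.of_isClosed_subset (hf.preimage_isClosed_of_isClosed isClosed_Icc isClosed_Ici)
      inter_subset_left
  obtain ⟨x, ⟨hx, hyx⟩, hlast⟩ := hcompact.exists_isGreatest ⟨a, left_mem_Icc.2 hab, hy.2.le⟩
  obtain ⟨t, ht, hty⟩ := intermediate_value_Icc' hx.2 (hf.mono (Icc_subset_Icc_left hx.1))
    ⟨hy.1.le, hyx⟩
  have htx : t = x := le_antisymm (hlast ⟨⟨hx.1.trans ht.1, ht.2⟩, hty.ge⟩) ht.1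
  have hfx : f x = y := htx ▸ hty
  have hxa : a ≠ x := fun h => hy.2.ne' (h ▸ hfx)
  have hxb : x ≠ b := fun h => hy.1.ne (h ▸ hfx)
  have hx' : x ∈ Ioo a b := ⟨hx.1.lt_of_ne hxa, hx.2.lt_of_ne hxb⟩
  have hxS : x ∉ S := fun h => hyS ⟨x, h, hfx⟩
  have hslope : ∀ᶠ t in 𝓝[>] x, 0 < slope f x t :=
    ((hasDerivWithinAt_iff_tendsto_slope' self_notMem_Ioi).1
      (hd x hx' hxS).hasDerivWithinAt).eventually_const_lt (hpos x hx' hxS)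
  obtain ⟨t, hslope, ht⟩ := (hslope.and (Ioo_mem_nhdsGT hx'.2)).exists
  have hft : f x < f t := by
    rw [slope_def_field] at hslope
    linarith [(div_pos_iff_of_pos_right (sub_pos.2 ht.1)).1 hslope]
  exact (hlast ⟨⟨hx.1.trans ht.1.le, ht.2.le⟩, hfx ▸ hft.le⟩).not_gt ht.1

theorem monotoneOn_of_hasDerivAt_nonneg_off_countable (hS : S.Countable)
    (hf : ContinuousOn f (Icc a b)) (hd : ∀ x ∈ Ioo a b, x ∉ S → HasDerivAt f (f' x) x)
    (hnonneg : ∀ x ∈ Ioo a b, x ∉ S → 0 ≤ f' x) : MonotoneOn f (Icc a b) := by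
  intro x hx y hy hxy
  by_contra! hlt
  obtain ⟨ε, hε, hεlt⟩ := exists_pos_mul_lt (sub_pos.2 hlt) (y - x)
  have hsub : Ioo x y ⊆ Ioo a b := Ioo_subset_Ioo hx.1 hy.2
  have hle : f x + ε * x ≤ f y + ε * y :=
    le_of_hasDerivAt_pos_off_countable (f := fun t => f t + ε * t) (f' := fun t => f' t + ε) hS hxy
      ((hf.mono (Icc_subset_Icc hx.1 hy.2)).add (by fun_prop))
      (fun t ht htS => (hd t (hsub ht) htS).add (by simpa using (hasDerivAt_id t).const_mul ε))
      (fun t ht htS => add_pos_of_nonneg_of_pos (hnonneg t (hsub ht) htS) hε)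
  linarith

theorem deriv_eq_zero_of_nonneg_of_endpoints_eq (hS : S.Countable)
    (hf : ContinuousOn f (Icc a b)) (hd : ∀ x ∈ Ioo a b, x ∉ S → HasDerivAt f (f' x) x)
    (hnonneg : ∀ x ∈ Ioo a b, x ∉ S → 0 ≤ f' x) (hab : f a = f b) {x : ℝ}
    (hx : x ∈ Ioo a b) (hxS : x ∉ S) : f' x = 0 := by
  have hmono := monotoneOn_of_hasDerivAt_nonneg_off_countable hS hf hd hnonneg
  have hle : a ≤ b := (hx.1.trans hx.2).le
  have hconst : f =ᶠ[𝓝 x] fun _ => f a := by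
    filter_upwards [Ioo_mem_nhds hx.1 hx.2] with y hy
    have hy' := Ioo_subset_Icc_self hy
    exact le_antisymm ((hmono hy' (right_mem_Icc.2 hle) hy.2.le).trans hab.ge)
      (hmono (left_mem_Icc.2 hle) hy' hy.1.le)
  exact (hd x hx hxS).unique ((hasDerivAt_const x (f a)).congr_of_eventuallyEq hconst)

theorem monotoneOn_exp_mul_off_countable {k : ℝ} (hS : S.Countable)
    (hf : ContinuousOn f (Icc a b)) (hd : ∀ x ∈ Ioo a b, x ∉ S → HasDerivAt f (f' x) x)
    (hbd : ∀ x ∈ Ioo a b, x ∉ S → 0 ≤ k * f x + f' x) :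
    MonotoneOn (fun x => Real.exp (k * x) * f x) (Icc a b) := by
  refine monotoneOn_of_hasDerivAt_nonneg_off_countable hS
    (f' := fun x => Real.exp (k * x) * (k * f x + f' x))
    ((Continuous.continuousOn (by fun_prop)).mul hf) (fun x hx hxS => ?_)
    (fun x hx hxS => mul_nonneg (Real.exp_pos _).le (hbd x hx hxS))
  have hexp : HasDerivAt (fun x => Real.exp (k * x)) (Real.exp (k * x) * k) x := by
    simpa using ((hasDerivAt_id x).const_mul k).exp
  exact (hexp.mul (hd x hx hxS)).congr_deriv (by ring)

theorem nonpos_of_abs_deriv_le_mul_off_countable {K x₀ x : ℝ} (hS : S.Countable)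
    (hf : ContinuousOn f (Icc a b)) (hd : ∀ x ∈ Ioo a b, x ∉ S → HasDerivAt f (f' x) x)
    (hbd : ∀ x ∈ Ioo a b, x ∉ S → |f' x| ≤ K * f x) (hx₀ : x₀ ∈ Icc a b) (hfx₀ : f x₀ = 0)
    (hx : x ∈ Icc a b) : f x ≤ 0 := by
  rcases le_total x x₀ with hle | hle
  · have hmono := monotoneOn_exp_mul_off_countable (k := K) hS hf hd
      (fun t ht htS => by linarith [(abs_le.1 (hbd t ht htS)).1]) hx hx₀ hle
    simp only [hfx₀, mul_zero] at hmono
    exact nonpos_of_mul_nonpos_right hmono (Real.exp_pos _)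
  · have hmono := monotoneOn_exp_mul_off_countable (f := fun t => -f t) (k := -K) hS hf.neg
      (fun t ht htS => (hd t ht htS).neg)
      (fun t ht htS => by linarith [(abs_le.1 (hbd t ht htS)).2]) hx₀ hx hle
    simp only [hfx₀, neg_zero, mul_zero] at hmono
    exact neg_nonneg.1 (nonneg_of_mul_nonneg_right hmono (Real.exp_pos _))

theorem exists_ne_zero_off_countable {E : Type*} [TopologicalSpace E] [T1Space E] [Zero E]
    {g : ℝ → E} (hab : a < b) (hS : S.Countable) (hg : ContinuousOn g (Icc a b))
    (hne : ∃ x ∈ Icc a b, g x ≠ 0) : ∃ x ∈ Ioo a b, x ∉ S ∧ g x ≠ 0 := by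
  by_contra! hzero
  obtain ⟨x, hx, hgx⟩ := hne
  have hdense : Icc a b ⊆ closure (Ioo a b ∩ Sᶜ) := by
    rw [← closure_Ioo hab.ne]
    exact closure_minimal ((hS.dense_compl ℝ).open_subset_closure_inter isOpen_Ioo)
      isClosed_closure
  have hmem := ((hg x hx).mono (inter_subset_left.trans Ioo_subset_Icc_self)).mem_closure
    (hdense hx) (t := {0}) fun y hy => hzero y hy.1 hy.2
  exact hgx (by simpa using hmem)

end OffCountable

/-! ### Solutions of the string equation and Picone's identity -/

/-- The discontinuities of `p` in the open interval `(0, 1)`, where the differential equation of the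
string carries no information. -/
def interiorDiscontinuities (p : ℝ → ℝ) : Set ℝ := {x ∈ Ioo (0 : ℝ) 1 | ¬ ContinuousAt p x}

theorem continuousAt_of_notMem_interiorDiscontinuities {p : ℝ → ℝ} {x : ℝ} (hx : x ∈ Ioo (0 : ℝ) 1)
    (hxS : x ∉ interiorDiscontinuities p) : ContinuousAt p x :=
  not_not.1 fun h => hxS ⟨hx, h⟩

/-- Coefficients `p` for which the initial value problem of `-u'' = l p u` on `[0, 1]` is
well-posed: bounded, with at most countably many discontinuities. -/
structure IsCoefficient (p : ℝ → ℝ) : Prop where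
  countable : (interiorDiscontinuities p).Countable
  bounded : ∃ B : ℝ, ∀ x ∈ Icc (0 : ℝ) 1, |p x| ≤ B

/-- String densities with countably many discontinuities, bounded and bounded away from `0`. -/
structure IsBoundedDensity (p : ℝ → ℝ) : Prop extends IsCoefficient p where
  bounded_away : ∃ c : ℝ, 0 < c ∧ ∀ x ∈ Icc (0 : ℝ) 1, c ≤ p x

theorem IsBoundedDensity.pos {p : ℝ → ℝ} (hp : IsBoundedDensity p) {x : ℝ}
    (hx : x ∈ Icc (0 : ℝ) 1) : 0 < p x := by
  obtain ⟨c, hc, hcp⟩ := hp.bounded_away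
  exact hc.trans_le (hcp x hx)

theorem isBoundedDensity_one : IsBoundedDensity fun _ => 1 where
  countable := by simp [interiorDiscontinuities, continuousAt_const]
  bounded := ⟨1, by simp⟩
  bounded_away := ⟨1, one_pos, fun _ _ => le_rfl⟩

theorem PiecewiseContinuous.exists_bound {p : ℝ → ℝ} (hp : PiecewiseContinuous p) :
    ∃ B : ℝ, ∀ x ∈ Icc (0 : ℝ) 1, |p x| ≤ B := by
  refine isCompact_Icc.induction_on (p := fun s => ∃ B : ℝ, ∀ x ∈ s, |p x| ≤ B) ⟨0, by simp⟩
    (fun s t hst ⟨B, hB⟩ => ⟨B, fun x hx => hB x (hst hx)⟩)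
    (fun s t ⟨B, hB⟩ ⟨C, hC⟩ => ⟨max B C, fun x hx => hx.elim
      (fun hs => (hB x hs).trans (le_max_left _ _)) (fun ht => (hC x ht).trans (le_max_right _ _))⟩)
    fun x hx => ?_
  have eventually_le : ∀ {L : ℝ} {F : Filter ℝ}, Tendsto p F (𝓝 L) → ∀ᶠ y in F, |p y| ≤ |L| + 1 :=
    fun h => (h.abs.eventually_lt_const (lt_add_one _)).mono fun _ => le_of_lt
  have hright : ∃ B : ℝ, ∀ᶠ y in 𝓝[>] x, y ∈ Icc (0 : ℝ) 1 → |p y| ≤ B := by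
    rcases hx.2.lt_or_eq with h | rfl
    · obtain ⟨L, hL⟩ := hp.2.1 x ⟨hx.1, h⟩
      exact ⟨|L| + 1, (eventually_le hL).mono fun _ hy _ => hy⟩
    · exact ⟨0, eventually_mem_nhdsWithin.mono fun y hy hy' => absurd hy'.2 (not_le.2 hy)⟩
  have hleft : ∃ B : ℝ, ∀ᶠ y in 𝓝[<] x, y ∈ Icc (0 : ℝ) 1 → |p y| ≤ B := by
    rcases hx.1.lt_or_eq with h | rfl
    · obtain ⟨L, hL⟩ := hp.2.2 x ⟨h, hx.2⟩
      exact ⟨|L| + 1, (eventually_le hL).mono fun _ hy _ => hy⟩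
    · exact ⟨0, eventually_mem_nhdsWithin.mono fun y hy hy' => absurd hy'.1 (not_le.2 hy)⟩
  obtain ⟨B, hB⟩ := hright
  obtain ⟨C, hC⟩ := hleft
  have hnear : ∀ᶠ y in 𝓝 x, y ∈ Icc (0 : ℝ) 1 → |p y| ≤ max (max B C) |p x| := by
    rw [← nhdsNE_sup_pure, ← nhdsLT_sup_nhdsGT, eventually_sup, eventually_sup, eventually_pure]
    exact ⟨⟨hC.mono fun y hy hy' => by simp [hy hy'], hB.mono fun y hy hy' => by simp [hy hy']⟩,
      fun _ => le_max_right _ _⟩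
  exact ⟨{y | |p y| ≤ max (max B C) |p x|}, mem_nhdsWithin_iff_eventually.2 hnear, _, fun _ => id⟩

theorem IsDensity.isBoundedDensity {p : ℝ → ℝ} (hp : IsDensity p) : IsBoundedDensity p where
  countable := hp.piecewiseContinuous.1.countable
  bounded := hp.piecewiseContinuous.exists_bound
  bounded_away := hp.bounded_away

/-- `u`, with derivative `w`, is a real solution of `-u'' = l p u` on `[0, 1]`. -/
structure IsStringSolution (p : ℝ → ℝ) (l : ℝ) (u w : ℝ → ℝ) : Prop where
  hasDeriv : ∀ x ∈ Icc (0 : ℝ) 1, HasDerivWithinAt u (w x) (Icc 0 1) x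
  continuousOn_deriv : ContinuousOn w (Icc 0 1)
  equation : ∀ x ∈ Ioo (0 : ℝ) 1, ContinuousAt p x → HasDerivAt w (-(l * p x * u x)) x

namespace IsStringSolution

variable {p : ℝ → ℝ} {l : ℝ} {u w : ℝ → ℝ}

theorem continuousOn (h : IsStringSolution p l u w) : ContinuousOn u (Icc 0 1) :=
  fun x hx => (h.hasDeriv x hx).continuousWithinAt

theorem hasDerivAt (h : IsStringSolution p l u w) {x : ℝ} (hx : x ∈ Ioo (0 : ℝ) 1) :
    HasDerivAt u (w x) x :=
  (h.hasDeriv x (Ioo_subset_Icc_self hx)).hasDerivAt (Icc_mem_nhds hx.1 hx.2)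

theorem hasDerivAt_deriv (h : IsStringSolution p l u w) {x : ℝ} (hx : x ∈ Ioo (0 : ℝ) 1)
    (hxS : x ∉ interiorDiscontinuities p) : HasDerivAt w (-(l * p x * u x)) x :=
  h.equation x hx (continuousAt_of_notMem_interiorDiscontinuities hx hxS)

theorem eq_zero_of_cauchy_data (h : IsStringSolution p l u w) (hp : IsCoefficient p) {x₀ x : ℝ}
    (hx₀ : x₀ ∈ Icc (0 : ℝ) 1) (hu : u x₀ = 0) (hw : w x₀ = 0) (hx : x ∈ Icc (0 : ℝ) 1) :
    u x = 0 ∧ w x = 0 := by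
  obtain ⟨B, hB⟩ := hp.bounded
  have henergy : u x ^ 2 + w x ^ 2 ≤ 0 := by
    refine nonpos_of_abs_deriv_le_mul_off_countable (f := fun x => u x ^ 2 + w x ^ 2)
      (f' := fun x => 2 * u x * w x * (1 - l * p x)) (K := 1 + |l| * B) hp.countable
      ((h.continuousOn.pow 2).add (h.continuousOn_deriv.pow 2)) (fun y hy hyS => ?_)
      (fun y hy _ => ?_) hx₀ (by simp [hu, hw]) hx
    · refine (((h.hasDerivAt hy).pow 2).add ((h.hasDerivAt_deriv hy hyS).pow 2)).congr_deriv ?_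
      push_cast
      ring
    · have hcoeff : |1 - l * p y| ≤ 1 + |l| * B := by
        refine (abs_sub _ _).trans ?_
        rw [abs_one, abs_mul]
        gcongr
        exact hB y (Ioo_subset_Icc_self hy)
      have hAMGM : |2 * u y * w y| ≤ u y ^ 2 + w y ^ 2 :=
        abs_le.2 ⟨by nlinarith [sq_nonneg (u y + w y)], two_mul_le_add_sq _ _⟩
      rw [abs_mul, mul_comm]
      exact mul_le_mul hcoeff hAMGM (abs_nonneg _) ((abs_nonneg _).trans hcoeff)
  constructor <;> nlinarith [sq_nonneg (u x), sq_nonneg (w x)]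

theorem deriv_ne_zero_of_eq_zero (h : IsStringSolution p l u w) (hp : IsCoefficient p)
    (hne : ∃ x ∈ Icc (0 : ℝ) 1, u x ≠ 0) {x : ℝ} (hx : x ∈ Icc (0 : ℝ) 1) (hux : u x = 0) :
    w x ≠ 0 := by
  obtain ⟨y, hy, huy⟩ := hne
  exact fun hwx => huy (h.eq_zero_of_cauchy_data hp hx hux hwx hy).1

theorem pos_of_nonneg (h : IsStringSolution p l u w) (hp : IsCoefficient p)
    (hne : ∃ x ∈ Icc (0 : ℝ) 1, u x ≠ 0) (hnonneg : ∀ x ∈ Icc (0 : ℝ) 1, 0 ≤ u x) {x : ℝ}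
    (hx : x ∈ Ioo (0 : ℝ) 1) : 0 < u x := by
  have hx' := Ioo_subset_Icc_self hx
  refine (hnonneg x hx').lt_of_ne' fun hux =>
    h.deriv_ne_zero_of_eq_zero hp hne hx' hux ?_
  have hmin : IsLocalMin u x := by
    filter_upwards [Icc_mem_nhds hx.1 hx.2] with y hy
    exact hux ▸ hnonneg y hy
  exact hmin.hasDerivAt_eq_zero (h.hasDerivAt hx)

theorem deriv_one_nonpos_of_nonneg (h : IsStringSolution p l u w)
    (hnonneg : ∀ x ∈ Icc (0 : ℝ) 1, 0 ≤ u x) (hu : u 1 = 0) : w 1 ≤ 0 := by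
  have hslope := h.hasDeriv 1 (right_mem_Icc.2 zero_le_one)
  rw [hasDerivWithinAt_iff_tendsto_slope, Icc_sdiff_right] at hslope
  have : (𝓝[Ico (0 : ℝ) 1] 1).NeBot := right_nhdsWithin_Ico_neBot zero_lt_one
  refine le_of_tendsto hslope ?_
  filter_upwards [self_mem_nhdsWithin] with y hy
  rw [slope_def_field, hu, sub_zero]
  exact div_nonpos_of_nonneg_of_nonpos (hnonneg y (Ico_subset_Icc_self hy)) (sub_nonpos.2 hy.2.le)

end IsStringSolution

section Picone

/-- Picone's function of two solutions `u`, `v` with derivatives `w`, `z`: the flux in Picone's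
identity. The convention `x / 0 = 0` gives it the value `v z` at the zeros of `u`. -/
noncomputable def picone (u w v z : ℝ → ℝ) (x : ℝ) : ℝ := v x * z x - v x ^ 2 * w x / u x

variable {u w v z : ℝ → ℝ} {x : ℝ}

theorem hasDerivAt_picone {P Q : ℝ} (hu : HasDerivAt u (w x) x) (hw : HasDerivAt w (-(P * u x)) x)
    (hv : HasDerivAt v (z x) x) (hz : HasDerivAt z (-(Q * v x)) x) (hux : u x ≠ 0) :
    HasDerivAt (picone u w v z) ((z x - v x * w x / u x) ^ 2 + (P - Q) * v x ^ 2) x := by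
  refine ((hv.mul hz).sub (((hv.pow 2).mul hw).div hu hux)).congr_deriv ?_
  simp only [Pi.mul_apply, Pi.pow_apply]
  field_simp
  push_cast
  ring

theorem tendsto_sq_mul_div_of_simple_zero {s : Set ℝ} {g : ℝ → ℝ} {u' v' : ℝ}
    (hu : HasDerivWithinAt u u' s x) (hv : HasDerivWithinAt v v' s x)
    (hg : ContinuousWithinAt g s x) (hux : u x = 0) (hvx : v x = 0) (hu' : u' ≠ 0) :
    Tendsto (fun y => v y ^ 2 * g y / u y) (𝓝[s] x) (𝓝 0) := by
  have hslopes :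
      Tendsto (fun y => v y * g y * (slope v x y / slope u x y)) (𝓝[s \ {x}] x) (𝓝 0) := by
    have hlim := ((hv.continuousWithinAt.mono sdiff_subset).mul (hg.mono sdiff_subset)).tendsto.mul
      ((hasDerivWithinAt_iff_tendsto_slope.1 hv).div (hasDerivWithinAt_iff_tendsto_slope.1 hu) hu')
    simpa [hvx] using hlim
  have hpunctured : Tendsto (fun y => v y ^ 2 * g y / u y) (𝓝[s \ {x}] x) (𝓝 0) := by
    refine hslopes.congr' ?_
    filter_upwards [self_mem_nhdsWithin] with y hy
    have hyx : y - x ≠ 0 := sub_ne_zero.2 hy.2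
    rw [slope_def_field, slope_def_field, hux, hvx, sub_zero, sub_zero,
      div_div_div_cancel_right₀ hyx]
    ring
  have hval : v x ^ 2 * g x / u x = 0 := by rw [hux, div_zero]
  rw [← hval] at hpunctured ⊢
  exact continuousWithinAt_sdiff_self.1 hpunctured

theorem continuousWithinAt_picone {s : Set ℝ} (hu : HasDerivWithinAt u (w x) s x)
    (hw : ContinuousWithinAt w s x) (hv : HasDerivWithinAt v (z x) s x)
    (hz : ContinuousWithinAt z s x) (hzero : u x = 0 → w x ≠ 0 ∧ v x = 0) :
    ContinuousWithinAt (picone u w v z) s x := by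
  refine (hv.continuousWithinAt.mul hz).sub ?_
  by_cases hux : u x = 0
  · obtain ⟨hwx, hvx⟩ := hzero hux
    simpa [ContinuousWithinAt, hux] using tendsto_sq_mul_div_of_simple_zero hu hv hw hux hvx hwx
  · exact ((hv.continuousWithinAt.pow 2).mul hw).div hu.continuousWithinAt hux

theorem picone_eq_zero (hW : v x * (z x * u x - v x * w x) = 0) (hzero : u x = 0 → v x = 0) :
    picone u w v z x = 0 := by
  by_cases hux : u x = 0
  · simp [picone, hzero hux]
  · unfold picone
    field_simp
    linear_combination hW

theorem IsStringSolution.not_forall_lt_of_pos {p q : ℝ → ℝ} {l m : ℝ}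
    (hu : IsStringSolution p l u w) (hv : IsStringSolution q m v z) (hp : IsCoefficient p)
    (hq : (interiorDiscontinuities q).Countable) (hpos : ∀ x ∈ Ioo (0 : ℝ) 1, 0 < u x)
    (hne : ∃ x ∈ Icc (0 : ℝ) 1, v x ≠ 0) (h0 : v 0 * (z 0 * u 0 - v 0 * w 0) = 0)
    (h1 : v 1 * (z 1 * u 1 - v 1 * w 1) = 0) :
    ¬ ∀ x ∈ Ioo (0 : ℝ) 1, m * q x < l * p x := by
  intro hlt
  have hune : ∃ x ∈ Icc (0 : ℝ) 1, u x ≠ 0 := ⟨1 / 2, by norm_num, (hpos _ (by norm_num)).ne'⟩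
  have hzero : ∀ e ∈ Icc (0 : ℝ) 1, v e * (z e * u e - v e * w e) = 0 →
      u e = 0 → w e ≠ 0 ∧ v e = 0 := fun e he hWe hue => by
    have hwe := hu.deriv_ne_zero_of_eq_zero hp hune he hue
    simpa [hue, hwe] using hWe
  have hI0 : (0 : ℝ) ∈ Icc (0 : ℝ) 1 := left_mem_Icc.2 zero_le_one
  have hI1 : (1 : ℝ) ∈ Icc (0 : ℝ) 1 := right_mem_Icc.2 zero_le_one
  have hcont : ContinuousOn (picone u w v z) (Icc 0 1) := fun x hx => by
    refine continuousWithinAt_picone (hu.hasDeriv x hx) (hu.continuousOn_deriv x hx)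
      (hv.hasDeriv x hx) (hv.continuousOn_deriv x hx) fun hux => ?_
    rcases eq_endpoints_or_mem_Ioo_of_mem_Icc hx with rfl | rfl | hx'
    · exact hzero _ hI0 h0 hux
    · exact hzero _ hI1 h1 hux
    · exact absurd hux (hpos x hx').ne'
  have hends : picone u w v z 0 = picone u w v z 1 :=
    (picone_eq_zero h0 fun hue => (hzero _ hI0 h0 hue).2).trans
      (picone_eq_zero h1 fun hue => (hzero _ hI1 h1 hue).2).symm
  have hS : (interiorDiscontinuities p ∪ interiorDiscontinuities q).Countable :=
    hp.countable.union hq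
  obtain ⟨x, hx, hxS, hvx⟩ := exists_ne_zero_off_countable zero_lt_one hS hv.continuousOn hne
  have hderiv_zero := deriv_eq_zero_of_nonneg_of_endpoints_eq hS hcont
    (fun y hy hyS => hasDerivAt_picone (hu.hasDerivAt hy)
      (hu.hasDerivAt_deriv hy fun h => hyS (Or.inl h)) (hv.hasDerivAt hy)
      (hv.hasDerivAt_deriv hy fun h => hyS (Or.inr h)) (hpos y hy).ne')
    (fun y hy _ => add_nonneg (sq_nonneg _)
      (mul_nonneg (sub_nonneg.2 (hlt y hy).le) (sq_nonneg _))) hends hx hxS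
  have hderiv_pos : 0 < (z x - v x * w x / u x) ^ 2 + (l * p x - m * q x) * v x ^ 2 :=
    add_pos_of_nonneg_of_pos (sq_nonneg _) (mul_pos (sub_pos.2 (hlt x hx)) (by positivity))
  exact hderiv_pos.ne' hderiv_zero

end Picone

/-! ### Positivity by comparison with subsolutions -/

section Subsolution

variable {u w ψ ψ' : ℝ → ℝ}

theorem pos_of_wronskian_pos {a b x : ℝ} (hu : ContinuousOn u (Icc a b))
    (hu' : ∀ x ∈ Ioo a b, HasDerivAt u (w x) x) (hψ : ∀ x, 0 < ψ x)
    (hψ' : ∀ x, HasDerivAt ψ (ψ' x) x) (hW : ∀ x ∈ Ioo a b, 0 < w x * ψ x - u x * ψ' x)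
    (hua : 0 ≤ u a) (hx : x ∈ Ioc a b) : 0 < u x := by
  have hψcont : Continuous ψ := continuous_iff_continuousAt.2 fun x => (hψ' x).continuousAt
  have hmono : StrictMonoOn (fun y => u y / ψ y) (Icc a b) := by
    refine strictMonoOn_of_deriv_pos (convex_Icc a b)
      (hu.div hψcont.continuousOn fun y _ => (hψ y).ne') fun y hy => ?_
    rw [interior_Icc] at hy
    rw [((hu' y hy).fun_div (hψ' y) (hψ y).ne').deriv]
    exact div_pos (hW y hy) (pow_pos (hψ y) 2)
  have hlt : u a / ψ a < u x / ψ x :=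
    hmono (left_mem_Icc.2 (hx.1.le.trans hx.2)) (Ioc_subset_Icc_self hx) hx.1
  exact (div_pos_iff_of_pos_right (hψ x)).1 ((div_nonneg hua (hψ a).le).trans_lt hlt)

theorem IsStringSolution.pos_of_subsolution {p : ℝ → ℝ} {l : ℝ} {ψ'' : ℝ → ℝ}
    (h : IsStringSolution p l u w) (hS : (interiorDiscontinuities p).Countable)
    (hψ : ∀ x, 0 < ψ x) (hψ' : ∀ x, HasDerivAt ψ (ψ' x) x)
    (hψ'' : ∀ x, HasDerivAt ψ' (ψ'' x) x)
    (hsub : ∀ x ∈ Ioo (0 : ℝ) 1, l * p x * ψ x + ψ'' x ≤ 0) (hu0 : 0 ≤ u 0)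
    (hW0 : 0 < w 0 * ψ 0 - u 0 * ψ' 0) :
    (∀ x ∈ Ioc (0 : ℝ) 1, 0 < u x) ∧ 0 < w 1 * ψ 1 - u 1 * ψ' 1 := by
  set W : ℝ → ℝ := fun x => w x * ψ x - u x * ψ' x
  have hψcont : Continuous ψ := continuous_iff_continuousAt.2 fun x => (hψ' x).continuousAt
  have hψ'cont : Continuous ψ' := continuous_iff_continuousAt.2 fun x => (hψ'' x).continuousAt
  have hWcont : ContinuousOn W (Icc 0 1) :=
    (h.continuousOn_deriv.mul hψcont.continuousOn).sub (h.continuousOn.mul hψ'cont.continuousOn)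
  have hpos : ∀ x ∈ Icc (0 : ℝ) 1, (∀ y ∈ Ioo 0 x, 0 < W y) → ∀ y ∈ Ioc 0 x, 0 < u y :=
    fun x hx hW y hy => pos_of_wronskian_pos (h.continuousOn.mono (Icc_subset_Icc_right hx.2))
      (fun t ht => h.hasDerivAt (Ioo_subset_Ioo_right hx.2 ht)) hψ hψ' hW hu0 hy
  have hWpos : ∀ x ∈ Icc (0 : ℝ) 1, 0 < W x := by
    by_contra! hW
    -- Up to the first zero of `W`, the quotient `u / ψ` increases, so `u ≥ 0`; then `W` increases.
    have hcompact : IsCompact (Icc 0 1 ∩ W ⁻¹' Iic 0) :=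
      isCompact_Icc.of_isClosed_subset
        (hWcont.preimage_isClosed_of_isClosed isClosed_Icc isClosed_Iic) inter_subset_left
    obtain ⟨x, ⟨hx, hWx⟩, hfirst⟩ := hcompact.exists_isLeast hW
    have hWbefore : ∀ y ∈ Ioo 0 x, 0 < W y := fun y hy =>
      not_le.1 fun hWy => (hfirst ⟨⟨hy.1.le, hy.2.le.trans hx.2⟩, hWy⟩).not_gt hy.2
    have hmono : MonotoneOn W (Icc 0 x) := by
      refine monotoneOn_of_hasDerivAt_nonneg_off_countable hS
        (f' := fun y => -(u y * (l * p y * ψ y + ψ'' y)))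
        (hWcont.mono (Icc_subset_Icc_right hx.2)) (fun y hy hyS => ?_) (fun y hy _ => ?_)
      · have hy' := Ioo_subset_Ioo_right hx.2 hy
        exact (((h.hasDerivAt_deriv hy' hyS).mul (hψ' y)).sub
          ((h.hasDerivAt hy').mul (hψ'' y))).congr_deriv (by ring)
      · have huy := hpos x hx hWbefore y (Ioo_subset_Ioc_self hy)
        exact neg_nonneg.2 (mul_nonpos_of_nonneg_of_nonpos huy.le
          (hsub y (Ioo_subset_Ioo_right hx.2 hy)))
    have hle : W 0 ≤ W x := hmono (left_mem_Icc.2 hx.1) (right_mem_Icc.2 hx.1) hx.1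
    exact (hW0.trans_le hle).not_ge hWx
  exact ⟨hpos 1 (right_mem_Icc.2 zero_le_one) fun y hy => hWpos y (Ioo_subset_Icc_self hy),
    hWpos 1 (right_mem_Icc.2 zero_le_one)⟩

theorem IsStringSolution.pos_of_very_negative {p : ℝ → ℝ} {c K l : ℝ}
    (h : IsStringSolution p l u w) (hS : (interiorDiscontinuities p).Countable)
    (hc : 0 < c) (hcp : ∀ x ∈ Icc (0 : ℝ) 1, c ≤ p x) (hK : 0 ≤ K)
    (hl : l * c ≤ -(2 * K + K ^ 2)) (hu0 : 0 ≤ u 0) (hw0 : 0 < w 0 + K * u 0) :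
    (∀ x ∈ Ioc (0 : ℝ) 1, 0 < u x) ∧ K * u 1 < w 1 := by
  -- `ψ' / ψ = θ` increases from `-K` to `K`, so that `ψ'' / ψ = θ² + 2 K ≤ K² + 2 K`.
  set ψ : ℝ → ℝ := fun x => Real.exp (K * (x ^ 2 - x)) with hψ
  set θ : ℝ → ℝ := fun x => K * (2 * x - 1) with hθ
  have hψ' : ∀ x, HasDerivAt ψ (ψ x * θ x) x := fun x => by
    simpa [hψ, hθ] using ((((hasDerivAt_id x).pow 2).sub (hasDerivAt_id x)).const_mul K).exp
  have hθ' : ∀ x, HasDerivAt θ (2 * K) x := fun x => by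
    simpa [hθ, mul_comm] using (((hasDerivAt_id x).const_mul 2).sub_const 1).const_mul K
  have hψ'' : ∀ x, HasDerivAt (fun x => ψ x * θ x) (ψ x * (θ x ^ 2 + 2 * K)) x := fun x =>
    ((hψ' x).mul (hθ' x)).congr_deriv (by ring)
  have hl0 : l ≤ 0 := nonpos_of_mul_nonpos_left (hl.trans (by nlinarith)) hc
  have hsub : ∀ x ∈ Ioo (0 : ℝ) 1, l * p x * ψ x + ψ x * (θ x ^ 2 + 2 * K) ≤ 0 := fun x hx => by
    have hlp : l * p x ≤ l * c := mul_le_mul_of_nonpos_left (hcp x (Ioo_subset_Icc_self hx)) hl0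
    have hθsq : θ x ^ 2 ≤ K ^ 2 := by
      refine sq_le_sq' ?_ ?_ <;> simp only [hθ] <;> nlinarith [hx.1, hx.2]
    nlinarith [Real.exp_pos (K * (x ^ 2 - x))]
  have hW0 : 0 < w 0 * ψ 0 - u 0 * (ψ 0 * θ 0) := by
    simpa [hψ, hθ, mul_comm K] using hw0
  obtain ⟨hpos, hW1⟩ :=
    h.pos_of_subsolution hS (fun x => Real.exp_pos _) hψ' hψ'' hsub hu0 hW0
  refine ⟨hpos, ?_⟩
  norm_num [hψ, hθ] at hW1
  linarith

end Subsolution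

/-! ### The initial value problem -/

section PowerSum

/-- Continuous functions on `s`, the coefficients of a power series in a parameter `l`, that are
dominated by the coefficients of `A * exp (B * l)`. -/
structure IsExpDominated {X : Type*} [TopologicalSpace X] (s : Set X) (A B : ℝ) (f : ℕ → X → ℝ) :
    Prop where
  continuousOn : ∀ n, ContinuousOn (f n) s
  abs_le : ∀ n, ∀ x ∈ s, |f n x| ≤ A * (B ^ n / n.factorial)

/-- The sum at `x` of the power series in `l` with coefficients `f n x`. -/
noncomputable def powerSum {X : Type*} (f : ℕ → X → ℝ) (l : ℝ) (x : X) : ℝ := ∑' n, l ^ n * f n x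

theorem summable_pow_mul_expCoeff (A B R : ℝ) :
    Summable fun n : ℕ => R ^ n * (A * (B ^ n / n.factorial)) := by
  refine ((Real.summable_pow_div_factorial (R * B)).mul_left A).congr fun n => ?_
  ring

namespace IsExpDominated

variable {X : Type*} [TopologicalSpace X] {s : Set X} {A B R l : ℝ} {f : ℕ → X → ℝ}

theorem abs_pow_mul_le (hf : IsExpDominated s A B f) (hl : |l| ≤ R) (n : ℕ) {x : X} (hx : x ∈ s) :
    |l ^ n * f n x| ≤ R ^ n * (A * (B ^ n / n.factorial)) := by
  rw [abs_mul, abs_pow]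
  exact mul_le_mul (pow_le_pow_left₀ (abs_nonneg l) hl n) (hf.abs_le n x hx) (abs_nonneg _)
    (pow_nonneg ((abs_nonneg l).trans hl) n)

theorem mono {t : Set X} (hf : IsExpDominated s A B f) (hts : t ⊆ s) : IsExpDominated t A B f where
  continuousOn n := (hf.continuousOn n).mono hts
  abs_le n x hx := hf.abs_le n x (hts hx)

theorem summable (hf : IsExpDominated s A B f) (l : ℝ) {x : X} (hx : x ∈ s) :
    Summable fun n => l ^ n * f n x :=
  .of_norm_bounded (summable_pow_mul_expCoeff A B |l|) fun n => hf.abs_pow_mul_le le_rfl n hx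

theorem continuousOn_powerSum (hf : IsExpDominated s A B f) :
    ContinuousOn (fun q : ℝ × X => powerSum f q.1 q.2) (univ ×ˢ s) := by
  intro q hq
  have hball : ContinuousOn (fun q : ℝ × X => powerSum f q.1 q.2)
      (Metric.ball 0 (|q.1| + 1) ×ˢ s) :=
    continuousOn_tsum
      (fun n => (continuous_fst.pow n).continuousOn.mul
        ((hf.continuousOn n).comp continuousOn_snd fun y hy => hy.2))
      (summable_pow_mul_expCoeff A B (|q.1| + 1))
      (fun n y hy => hf.abs_pow_mul_le (mem_ball_zero_iff.1 hy.1).le n hy.2)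
  have hq1 : q.1 ∈ Metric.ball 0 (|q.1| + 1) := mem_ball_zero_iff.2 (lt_add_one |q.1|)
  refine (hball q ⟨hq1, hq.2⟩).mono_of_mem_nhdsWithin ?_
  rw [← Prod.mk.eta (p := q), nhdsWithin_prod_eq, nhdsWithin_univ]
  exact prod_mem_prod (Metric.isOpen_ball.mem_nhds hq1) self_mem_nhdsWithin

end IsExpDominated

theorem IsExpDominated.hasSum_integral_mul {A B C a b l : ℝ} {f : ℕ → ℝ → ℝ} {g : ℝ → ℝ}
    (hf : IsExpDominated (uIcc a b) A B f) (hg : IntervalIntegrable g volume a b)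
    (hgC : ∀ x ∈ uIcc a b, |g x| ≤ C) :
    HasSum (fun n => l ^ n * ∫ t in a..b, g t * f n t) (∫ t in a..b, g t * powerSum f l t) := by
  simp_rw [← intervalIntegral.integral_const_mul, mul_left_comm]
  refine intervalIntegral.hasSum_integral_of_dominated_convergence
    (fun n _ => C * (|l| ^ n * (A * (B ^ n / n.factorial)))) (fun n => ?_)
    (fun n => ae_of_all _ fun t ht => ?_)
    (ae_of_all _ fun t _ => (summable_pow_mul_expCoeff A B |l|).mul_left C)
    intervalIntegrable_const
    (ae_of_all _ fun t ht => (hf.summable l (uIoc_subset_uIcc ht)).hasSum.mul_left (g t))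
  · exact (hg.mul_continuousOn
      (continuousOn_const.mul (hf.continuousOn n))).aestronglyMeasurable_restrict_uIoc
  · have ht' := uIoc_subset_uIcc ht
    rw [Real.norm_eq_abs, abs_mul]
    exact mul_le_mul (hgC t ht') (hf.abs_pow_mul_le le_rfl n ht') (abs_nonneg _)
      ((abs_nonneg _).trans (hgC t ht'))

end PowerSum

section InitialValueProblem

variable {p : ℝ → ℝ} {a b : ℝ}

theorem IsCoefficient.intervalIntegrable (hp : IsCoefficient p) :
    IntervalIntegrable p volume 0 1 := by
  obtain ⟨B, hB⟩ := hp.bounded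
  have hmeas : AEStronglyMeasurable p (volume.restrict (Ioo 0 1)) := by
    have hcont : ContinuousOn p (Ioo 0 1 \ interiorDiscontinuities p) := fun x hx =>
      (continuousAt_of_notMem_interiorDiscontinuities hx.1 hx.2).continuousWithinAt
    have hae : (Ioo (0 : ℝ) 1 \ interiorDiscontinuities p : Set ℝ) =ᵐ[volume] Ioo 0 1 :=
      sdiff_null_ae_eq_self (hp.countable.measure_zero volume)
    rw [← Measure.restrict_congr_set hae]
    exact hcont.aestronglyMeasurable (measurableSet_Ioo.diff hp.countable.measurableSet)
  rw [intervalIntegrable_iff_integrableOn_Ioo_of_le zero_le_one]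
  refine ⟨hmeas, .of_bounded (C := B) ?_⟩
  exact (ae_restrict_mem measurableSet_Ioo).mono fun x hx => hB x (Ioo_subset_Icc_self hx)

theorem IsCoefficient.intervalIntegrable_mul (hp : IsCoefficient p) {f : ℝ → ℝ}
    (hf : ContinuousOn f (Icc 0 1)) : IntervalIntegrable (fun x => p x * f x) volume 0 1 :=
  hp.intervalIntegrable.mul_continuousOn (by rwa [uIcc_of_le zero_le_one])

theorem IsStringSolution.of_integral_eq {l : ℝ} {u w : ℝ → ℝ} (hp : IsCoefficient p)
    (hu : ContinuousOn u (Icc 0 1)) (hw : ContinuousOn w (Icc 0 1))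
    (hu_eq : ∀ x ∈ Icc (0 : ℝ) 1, u x = a + ∫ t in 0..x, w t)
    (hw_eq : ∀ x ∈ Icc (0 : ℝ) 1, w x = b - l * ∫ t in 0..x, p t * u t) :
    IsStringSolution p l u w where
  hasDeriv x hx := by
    have : Fact (x ∈ Icc (0 : ℝ) 1) := ⟨hx⟩
    have hFTC : HasDerivWithinAt (fun y => ∫ t in 0..y, w t) (w x) (Icc 0 1) x :=
      intervalIntegral.integral_hasDerivWithinAt_right
        ((hw.mono (Icc_subset_Icc_right hx.2)).intervalIntegrable_of_Icc hx.1)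
        (hw.stronglyMeasurableAtFilter_nhdsWithin measurableSet_Icc x) (hw x hx)
    exact (hFTC.const_add a).congr_of_mem hu_eq hx
  continuousOn_deriv := hw
  equation x hx hpx := by
    have hux : ContinuousAt u x := hu.continuousAt (Icc_mem_nhds hx.1 hx.2)
    have hint := hp.intervalIntegrable_mul hu
    have hFTC : HasDerivAt (fun y => ∫ t in 0..y, p t * u t) (p x * u x) x :=
      intervalIntegral.integral_hasDerivAt_right
        (hint.mono_set (uIcc_subset_uIcc_left (by simp [uIcc_of_le, hx.1.le, hx.2.le])))
        (AEStronglyMeasurable.stronglyMeasurableAtFilter_of_mem hint.aestronglyMeasurable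
          (Ioc_mem_nhds hx.1 hx.2))
        (hpx.mul hux)
    refine ((hFTC.const_mul l).const_sub b).congr_of_eventuallyEq ?_ |>.congr_deriv (by ring)
    filter_upwards [Icc_mem_nhds hx.1 hx.2] with y hy using hw_eq y hy

/-- The coefficients of `l ^ n` in the solution of `-u'' = l p u`, `u 0 = a`, `u' 0 = b` and in its
derivative. -/
noncomputable def initialValueCoeff (p : ℝ → ℝ) (a b : ℝ) : ℕ → (ℝ → ℝ) × (ℝ → ℝ)
  | 0 => (fun x => a + b * x, fun _ => b)
  | n + 1 => (fun x => ∫ t in 0..x, -∫ s in 0..t, p s * (initialValueCoeff p a b n).1 s,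
      fun x => -∫ t in 0..x, p t * (initialValueCoeff p a b n).1 t)

theorem continuousOn_initialValueCoeff (hp : IsCoefficient p) (n : ℕ) :
    ContinuousOn (initialValueCoeff p a b n).1 (Icc 0 1) ∧
      ContinuousOn (initialValueCoeff p a b n).2 (Icc 0 1) := by
  have hprimitive : ∀ {f : ℝ → ℝ}, IntervalIntegrable f volume 0 1 →
      ContinuousOn (fun x => ∫ t in 0..x, f t) (Icc 0 1) := fun hf => by
    simpa using intervalIntegral.continuousOn_primitive_interval' hf left_mem_uIcc
  induction n with
  | zero => exact ⟨by fun_prop, by fun_prop⟩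
  | succ n ih =>
    have hderiv := (hprimitive (hp.intervalIntegrable_mul ih.1)).neg
    exact ⟨hprimitive (hderiv.intervalIntegrable_of_Icc zero_le_one), hderiv⟩

theorem abs_integral_le_pow_div_factorial {f : ℝ → ℝ} {C x : ℝ} {n : ℕ} (hx : 0 ≤ x)
    (hf : ∀ t ∈ Ioc 0 x, |f t| ≤ C * (t ^ n / n.factorial)) :
    |∫ t in 0..x, f t| ≤ C * (x ^ (n + 1) / (n + 1).factorial) := by
  have hint : IntervalIntegrable (fun t => C * (t ^ n / n.factorial)) volume 0 x :=
    Continuous.intervalIntegrable (by fun_prop) _ _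
  refine (intervalIntegral.norm_integral_le_of_norm_le (f := f) hx (ae_of_all _ hf)
    hint).trans_eq ?_
  rw [intervalIntegral.integral_const_mul, intervalIntegral.integral_div, integral_pow,
    Nat.factorial_succ]
  push_cast
  field_simp
  simp

theorem abs_initialValueCoeff_le {B : ℝ} (hB : ∀ x ∈ Icc (0 : ℝ) 1, |p x| ≤ B) (n : ℕ) {x : ℝ}
    (hx : x ∈ Icc (0 : ℝ) 1) :
    |(initialValueCoeff p a b n).1 x| ≤ (|a| + |b|) * B ^ n * (x ^ n / n.factorial) ∧
      |(initialValueCoeff p a b n).2 x| ≤ (|a| + |b|) * B ^ n * (x ^ n / n.factorial) := by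
  have hB0 : 0 ≤ B := (abs_nonneg _).trans (hB x hx)
  induction n generalizing x with
  | zero =>
    refine ⟨?_, by simp [initialValueCoeff]⟩
    have hbx : |b * x| ≤ |b| := by
      rw [abs_mul, abs_of_nonneg hx.1]
      exact mul_le_of_le_one_right (abs_nonneg b) hx.2
    simpa [initialValueCoeff] using (abs_add_le a (b * x)).trans (by gcongr)
  | succ n ih =>
    have hderiv : ∀ {x}, x ∈ Icc (0 : ℝ) 1 → |(initialValueCoeff p a b (n + 1)).2 x| ≤
        (|a| + |b|) * B ^ (n + 1) * (x ^ (n + 1) / (n + 1).factorial) := fun {x} hx => by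
      simp only [initialValueCoeff, abs_neg]
      refine abs_integral_le_pow_div_factorial hx.1 fun t ht => ?_
      have ht' : t ∈ Icc (0 : ℝ) 1 := ⟨ht.1.le, ht.2.trans hx.2⟩
      rw [abs_mul]
      exact (mul_le_mul (hB t ht') (ih ht').1 (abs_nonneg _) hB0).trans_eq (by ring)
    refine ⟨?_, hderiv hx⟩
    have hbound : ∀ t ∈ uIoc 0 x, ‖(initialValueCoeff p a b (n + 1)).2 t‖ ≤
        (|a| + |b|) * B ^ (n + 1) * (x ^ (n + 1) / (n + 1).factorial) := fun t ht => by
      rw [uIoc_of_le hx.1] at ht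
      refine (hderiv ⟨ht.1.le, ht.2.trans hx.2⟩).trans ?_
      have := ht.1.le
      gcongr
      exact ht.2
    refine (intervalIntegral.norm_integral_le_of_norm_le_const hbound).trans ?_
    rw [sub_zero, abs_of_nonneg hx.1]
    exact mul_le_of_le_one_right (by have := hx.1; positivity) hx.2

theorem exists_isExpDominated_initialValueCoeff (hp : IsCoefficient p) (a b : ℝ) : ∃ A B,
    IsExpDominated (Icc 0 1) A B (fun n => (initialValueCoeff p a b n).1) ∧
      IsExpDominated (Icc 0 1) A B (fun n => (initialValueCoeff p a b n).2) := by
  obtain ⟨B, hB⟩ := hp.bounded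
  have hle : ∀ n : ℕ, ∀ x ∈ Icc (0 : ℝ) 1, (|a| + |b|) * B ^ n * (x ^ n / n.factorial) ≤
      (|a| + |b|) * (B ^ n / n.factorial) := fun n x hx => by
    have hB0 : 0 ≤ B := (abs_nonneg _).trans (hB x hx)
    rw [mul_assoc, ← mul_div_assoc]
    gcongr
    exact mul_le_of_le_one_right (pow_nonneg hB0 n) (pow_le_one₀ hx.1 hx.2)
  exact ⟨|a| + |b|, B,
    ⟨fun n => (continuousOn_initialValueCoeff hp n).1,
      fun n x hx => (abs_initialValueCoeff_le hB n hx).1.trans (hle n x hx)⟩,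
    ⟨fun n => (continuousOn_initialValueCoeff hp n).2,
      fun n x hx => (abs_initialValueCoeff_le hB n hx).2.trans (hle n x hx)⟩⟩

theorem powerSum_initialValueCoeff_fst {A B l x : ℝ}
    (hφ : IsExpDominated (Icc 0 1) A B fun n => (initialValueCoeff p a b n).1)
    (hχ : IsExpDominated (Icc 0 1) A B fun n => (initialValueCoeff p a b n).2)
    (hx : x ∈ Icc (0 : ℝ) 1) :
    powerSum (fun n => (initialValueCoeff p a b n).1) l x =
      a + ∫ t in 0..x, powerSum (fun n => (initialValueCoeff p a b n).2) l t := by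
  have hsub : uIcc 0 x ⊆ Icc (0 : ℝ) 1 := uIcc_of_le hx.1 ▸ Icc_subset_Icc_right hx.2
  have hint := (hχ.mono hsub).hasSum_integral_mul (g := 1) (C := 1) (l := l)
    intervalIntegrable_const (by simp)
  simp only [Pi.one_apply, one_mul] at hint
  rw [← hint.tsum_eq, hint.summable.tsum_eq_zero_add, powerSum,
    (hφ.summable l hx).tsum_eq_zero_add]
  simp [initialValueCoeff, add_assoc, mul_comm]

theorem powerSum_initialValueCoeff_snd {A B l x : ℝ} (hp : IsCoefficient p)
    (hφ : IsExpDominated (Icc 0 1) A B fun n => (initialValueCoeff p a b n).1)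
    (hχ : IsExpDominated (Icc 0 1) A B fun n => (initialValueCoeff p a b n).2)
    (hx : x ∈ Icc (0 : ℝ) 1) :
    powerSum (fun n => (initialValueCoeff p a b n).2) l x =
      b - l * ∫ t in 0..x, p t * powerSum (fun n => (initialValueCoeff p a b n).1) l t := by
  obtain ⟨C, hC⟩ := hp.bounded
  have hsub : uIcc 0 x ⊆ Icc (0 : ℝ) 1 := uIcc_of_le hx.1 ▸ Icc_subset_Icc_right hx.2
  have hint := (hφ.mono hsub).hasSum_integral_mul (l := l)
    (hp.intervalIntegrable.mono_set (by rwa [uIcc_of_le zero_le_one])) fun t ht => hC t (hsub ht)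
  rw [← hint.tsum_eq, powerSum, (hχ.summable l hx).tsum_eq_zero_add, ← tsum_mul_left]
  simp [initialValueCoeff, tsum_neg, pow_succ', mul_assoc, sub_eq_add_neg]

/-- The solutions `u l`, with derivatives `w l`, of `-u'' = l p u` with the initial data `u 0 = a`,
`u' 0 = b`, depending continuously on the parameter and the position. -/
structure IsInitialValueFamily (p : ℝ → ℝ) (a b : ℝ) (u w : ℝ → ℝ → ℝ) : Prop where
  isStringSolution : ∀ l, IsStringSolution p l (u l) (w l)
  initial : ∀ l, u l 0 = a
  initial_deriv : ∀ l, w l 0 = b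
  continuousOn : ContinuousOn (fun q : ℝ × ℝ => u q.1 q.2) (univ ×ˢ Icc 0 1)
  continuousOn_deriv : ContinuousOn (fun q : ℝ × ℝ => w q.1 q.2) (univ ×ˢ Icc 0 1)

theorem IsCoefficient.exists_isInitialValueFamily (hp : IsCoefficient p) (a b : ℝ) :
    ∃ u w, IsInitialValueFamily p a b u w := by
  obtain ⟨A, B, hφ, hχ⟩ := exists_isExpDominated_initialValueCoeff hp a b
  set φ : ℕ → ℝ → ℝ := fun n => (initialValueCoeff p a b n).1
  set χ : ℕ → ℝ → ℝ := fun n => (initialValueCoeff p a b n).2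
  have hu_eq := fun l x hx => powerSum_initialValueCoeff_fst hφ hχ (l := l) (x := x) hx
  have hw_eq := fun l x hx => powerSum_initialValueCoeff_snd hp hφ hχ (l := l) (x := x) hx
  have hslice : ∀ l : ℝ, MapsTo (Prod.mk l) (Icc (0 : ℝ) 1) (univ ×ˢ Icc 0 1) :=
    fun l x hx => ⟨mem_univ l, hx⟩
  refine ⟨powerSum φ, powerSum χ, fun l => .of_integral_eq hp
    (hφ.continuousOn_powerSum.comp (by fun_prop) (hslice l))
    (hχ.continuousOn_powerSum.comp (by fun_prop) (hslice l)) (hu_eq l) (hw_eq l),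
    fun l => ?_, fun l => ?_, hφ.continuousOn_powerSum, hχ.continuousOn_powerSum⟩
  · simpa using hu_eq l 0 (left_mem_Icc.2 zero_le_one)
  · simpa using hw_eq l 0 (left_mem_Icc.2 zero_le_one)

end InitialValueProblem

/-! ### Positive solutions of the boundary value problem -/

/-- Lexicographic positivity of the pair `(a, b)`. For the initial data `u 0 = a`, `u' 0 = b` it
says that `u` starts out positive. -/
def LexPos (a b : ℝ) : Prop := 0 < a ∨ a = 0 ∧ 0 < b

theorem LexPos.nonneg {a b : ℝ} (h : LexPos a b) : 0 ≤ a :=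
  h.elim le_of_lt fun h => h.1.ge

theorem LexPos.eventually_pos {a b : ℝ} (h : LexPos a b) : ∀ᶠ K in atTop, 0 < b + K * a := by
  rcases h with ha | ⟨rfl, hb⟩
  · exact (tendsto_atTop_add_const_left _ b (tendsto_id.atTop_mul_const ha)).eventually_gt_atTop 0
  · exact .of_forall fun K => by simpa using hb

theorem exists_lexPos_mul {a b : ℝ} (h : a ≠ 0 ∨ b ≠ 0) : ∃ ε ≠ 0, LexPos (ε * a) (ε * b) := by
  by_cases ha : a = 0
  · exact ⟨b, h.resolve_left (not_not.2 ha), Or.inr ⟨by simp [ha],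
      mul_self_pos.2 (h.resolve_left (not_not.2 ha))⟩⟩
  · exact ⟨a, ha, Or.inl (mul_self_pos.2 ha)⟩

theorem IsStringSolution.exists_ne_zero {p : ℝ → ℝ} {l : ℝ} {u w : ℝ → ℝ}
    (h : IsStringSolution p l u w) (h0 : u 0 ≠ 0 ∨ w 0 ≠ 0) : ∃ x ∈ Icc (0 : ℝ) 1, u x ≠ 0 := by
  by_contra! hzero
  have hI0 : (0 : ℝ) ∈ Icc (0 : ℝ) 1 := left_mem_Icc.2 zero_le_one
  have hderiv : HasDerivWithinAt u 0 (Icc 0 1) 0 :=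
    (hasDerivWithinAt_const _ _ 0).congr_of_mem hzero hI0
  have hw0 : w 0 = 0 := (uniqueDiffOn_Icc zero_lt_one 0 hI0).eq_deriv _ (h.hasDeriv 0 hI0) hderiv
  exact h0.elim (fun h => h (hzero 0 hI0)) (fun h => h hw0)

theorem isStringSolution_sin : IsStringSolution (fun _ => 1) (Real.pi ^ 2)
    (fun x => Real.sin (Real.pi * x)) (fun x => Real.pi * Real.cos (Real.pi * x)) where
  hasDeriv x _ := by
    simpa [mul_comm] using (((hasDerivAt_id x).const_mul Real.pi).sin).hasDerivWithinAt
  continuousOn_deriv := by fun_prop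
  equation x _ _ := by
    refine ((((hasDerivAt_id x).const_mul Real.pi).cos).const_mul Real.pi).congr_deriv ?_
    simp only [id_eq]
    ring

theorem IsStringSolution.le_pi_sq_div {p : ℝ → ℝ} {c l : ℝ} {u w : ℝ → ℝ}
    (h : IsStringSolution p l u w) (hp : IsCoefficient p) (hc : 0 < c)
    (hcp : ∀ x ∈ Icc (0 : ℝ) 1, c ≤ p x) (hpos : ∀ x ∈ Ioo (0 : ℝ) 1, 0 < u x) :
    l ≤ Real.pi ^ 2 / c := by
  by_contra! hlt
  have hl : 0 < l := (by positivity : 0 < Real.pi ^ 2 / c).trans hlt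
  refine h.not_forall_lt_of_pos isStringSolution_sin hp isBoundedDensity_one.countable hpos
    ⟨1 / 2, by norm_num, by simp [← div_eq_mul_inv]⟩ (by simp) (by simp) fun x hx => ?_
  calc Real.pi ^ 2 * 1 < l * c := by rw [mul_one]; exact (div_lt_iff₀ hc).1 hlt
    _ ≤ l * p x := by gcongr; exact hcp x (Ioo_subset_Icc_self hx)

namespace IsInitialValueFamily

variable {p : ℝ → ℝ} {a b s c l : ℝ} {u w : ℝ → ℝ → ℝ}

theorem continuous_parameter (h : IsInitialValueFamily p a b u w) {x : ℝ}
    (hx : x ∈ Icc (0 : ℝ) 1) : Continuous fun k => u k x :=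
  h.continuousOn.comp_continuous (f := fun k => (k, x)) (by fun_prop) fun _ => ⟨mem_univ _, hx⟩

theorem continuous_parameter_deriv (h : IsInitialValueFamily p a b u w) {x : ℝ}
    (hx : x ∈ Icc (0 : ℝ) 1) : Continuous fun k => w k x :=
  h.continuousOn_deriv.comp_continuous (f := fun k => (k, x)) (by fun_prop)
    fun _ => ⟨mem_univ _, hx⟩

theorem eventually_pos_near_zero (h : IsInitialValueFamily p a b u w) (hab : LexPos a b) (l : ℝ) :
    ∀ᶠ q : ℝ × ℝ in 𝓝 (l, 0), q.2 ∈ Ioc (0 : ℝ) 1 → 0 < u q.1 q.2 := by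
  have hmem : ((l, 0) : ℝ × ℝ) ∈ (univ ×ˢ Icc 0 1 : Set (ℝ × ℝ)) := by simp
  rcases hab with ha | ⟨rfl, hb⟩
  · have hnear := (h.continuousOn (l, 0) hmem).eventually_const_lt (by simpa [h.initial] using ha)
    filter_upwards [eventually_nhdsWithin_iff.1 hnear] with q hq hq2
    exact hq ⟨mem_univ _, Ioc_subset_Icc_self hq2⟩
  · have hnear := (h.continuousOn_deriv (l, 0) hmem).eventually_const_lt
      (by simpa [h.initial_deriv] using hb)
    obtain ⟨δ, hδ, hball⟩ := Metric.eventually_nhds_iff_ball.1 (eventually_nhdsWithin_iff.1 hnear)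
    filter_upwards [Metric.ball_mem_nhds (l, (0 : ℝ)) hδ] with q hq hq2
    have hw : ∀ y ∈ Ioo 0 q.2, 0 < w q.1 y := fun y hy => by
      refine hball (q.1, y) ?_ ⟨mem_univ _, hy.1.le, hy.2.le.trans hq2.2⟩
      rw [← ball_prod_same] at hq ⊢
      refine ⟨hq.1, ?_⟩
      have hq2δ := mem_ball_zero_iff.1 hq.2
      rw [Real.norm_of_nonneg hq2.1.le] at hq2δ
      rw [mem_ball_zero_iff, Real.norm_of_nonneg hy.1.le]
      exact hy.2.trans hq2δ
    have hsub : Icc 0 q.2 ⊆ Icc (0 : ℝ) 1 := Icc_subset_Icc_right hq2.2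
    have hmono : StrictMonoOn (u q.1) (Icc 0 q.2) := by
      refine strictMonoOn_of_deriv_pos (convex_Icc _ _)
        ((h.isStringSolution q.1).continuousOn.mono hsub) fun y hy => ?_
      rw [interior_Icc] at hy
      rw [((h.isStringSolution q.1).hasDerivAt ⟨hy.1, hy.2.trans_le hq2.2⟩).deriv]
      exact hw y hy
    simpa [h.initial] using hmono (left_mem_Icc.2 hq2.1.le) (right_mem_Icc.2 hq2.1.le) hq2.1

theorem eventually_forall_pos (h : IsInitialValueFamily p a b u w) (hab : LexPos a b)
    (hpos : ∀ x ∈ Ioc (0 : ℝ) 1, 0 < u l x) : ∀ᶠ k in 𝓝 l, ∀ x ∈ Ioc (0 : ℝ) 1, 0 < u k x := by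
  have hlocal : ∀ x ∈ Icc (0 : ℝ) 1, ∀ᶠ q : ℝ × ℝ in 𝓝 (l, x),
      q.2 ∈ Ioc (0 : ℝ) 1 → 0 < u q.1 q.2 := fun x hx => by
    rcases hx.1.eq_or_lt with rfl | hx0
    · exact h.eventually_pos_near_zero hab l
    · have hnear :=
        (h.continuousOn (l, x) ⟨mem_univ _, hx⟩).eventually_const_lt (hpos x ⟨hx0, hx.2⟩)
      filter_upwards [eventually_nhdsWithin_iff.1 hnear] with q hq hq2
      exact hq ⟨mem_univ _, Ioc_subset_Icc_self hq2⟩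
  filter_upwards [isCompact_Icc.eventually_forall_of_forall_eventually
    (P := fun k x => x ∈ Ioc (0 : ℝ) 1 → 0 < u k x) hlocal] with k hk x hx
  exact hk x (Ioc_subset_Icc_self hx) hx

end IsInitialValueFamily

/-- The parameters `l` for which `u l` is positive on `(0, 1]` and satisfies the strict inequality
`0 < s * u' 1 + c * u 1` in place of the boundary condition at `1`. -/
def positiveParameters (u w : ℝ → ℝ → ℝ) (s c : ℝ) : Set ℝ :=
  {l | (∀ x ∈ Ioc (0 : ℝ) 1, 0 < u l x) ∧ 0 < s * w l 1 + c * u l 1}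

namespace IsInitialValueFamily

variable {p : ℝ → ℝ} {a b s c : ℝ} {u w : ℝ → ℝ → ℝ}

theorem continuous_boundary (h : IsInitialValueFamily p a b u w) :
    Continuous fun l => s * w l 1 + c * u l 1 := by
  have hI1 : (1 : ℝ) ∈ Icc (0 : ℝ) 1 := right_mem_Icc.2 zero_le_one
  exact ((h.continuous_parameter_deriv hI1).const_mul s).add
    ((h.continuous_parameter hI1).const_mul c)

theorem isOpen_positiveParameters (h : IsInitialValueFamily p a b u w) (hab : LexPos a b) :
    IsOpen (positiveParameters u w s c) :=
  isOpen_iff_mem_nhds.2 fun _ hl => (h.eventually_forall_pos hab hl.1).and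
    (h.continuous_boundary.continuousAt.eventually_const_lt hl.2)

theorem nonempty_positiveParameters (h : IsInitialValueFamily p a b u w) (hp : IsBoundedDensity p)
    (hab : LexPos a b) (hsc : LexPos s c) : (positiveParameters u w s c).Nonempty := by
  obtain ⟨c₀, hc₀, hcp⟩ := hp.bounded_away
  obtain ⟨K, ⟨hKab, hKsc⟩, hK⟩ :=
    ((hab.eventually_pos.and hsc.eventually_pos).and (eventually_ge_atTop 0)).exists
  set l := -(2 * K + K ^ 2) / c₀
  obtain ⟨hpos, hw1⟩ := (h.isStringSolution l).pos_of_very_negative hp.countable hc₀ hcp hK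
    (div_mul_cancel₀ _ hc₀.ne').le (hab.nonneg.trans_eq (h.initial l).symm)
    (by rwa [h.initial, h.initial_deriv])
  refine ⟨l, hpos, ?_⟩
  calc 0 < (c + K * s) * u l 1 := mul_pos hKsc (hpos 1 (right_mem_Ioc.2 zero_lt_one))
    _ = s * (K * u l 1) + c * u l 1 := by ring
    _ ≤ s * w l 1 + c * u l 1 := by have := hsc.nonneg; gcongr

theorem bddAbove_positiveParameters (h : IsInitialValueFamily p a b u w)
    (hp : IsBoundedDensity p) : BddAbove (positiveParameters u w s c) := by
  obtain ⟨c₀, hc₀, hcp⟩ := hp.bounded_away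
  exact ⟨Real.pi ^ 2 / c₀, fun l hl => (h.isStringSolution l).le_pi_sq_div hp.toIsCoefficient hc₀
    hcp fun x hx => hl.1 x (Ioo_subset_Ioc_self hx)⟩

theorem sSup_positiveParameters_notMem (h : IsInitialValueFamily p a b u w)
    (hp : IsBoundedDensity p) (hab : LexPos a b) :
    sSup (positiveParameters u w s c) ∉ positiveParameters u w s c := fun hmem => by
  have hnear : ∀ᶠ k in 𝓝[>] sSup (positiveParameters u w s c), k ∈ positiveParameters u w s c :=
    nhdsWithin_le_nhds ((h.isOpen_positiveParameters hab).mem_nhds hmem)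
  obtain ⟨k, hk, hlt⟩ := (hnear.and eventually_mem_nhdsWithin).exists
  exact (le_csSup (h.bddAbove_positiveParameters hp) hk).not_gt hlt

theorem nonneg_of_mem_closure (h : IsInitialValueFamily p a b u w) (ha : 0 ≤ a) {l : ℝ}
    (hl : l ∈ closure (positiveParameters u w s c)) :
    (∀ x ∈ Icc (0 : ℝ) 1, 0 ≤ u l x) ∧ 0 ≤ s * w l 1 + c * u l 1 := by
  constructor
  · intro x hx
    rcases hx.1.eq_or_lt with rfl | hx0
    · exact ha.trans_eq (h.initial l).symm
    · exact closure_minimal (fun k hk => (hk.1 x ⟨hx0, hx.2⟩).le)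
        (isClosed_le continuous_const (h.continuous_parameter hx)) hl
  · exact closure_minimal (fun k hk => hk.2.le)
      (isClosed_le continuous_const h.continuous_boundary) hl

end IsInitialValueFamily

theorem IsBoundedDensity.exists_pos_isStringSolution {p : ℝ → ℝ} {a b s c : ℝ}
    (hp : IsBoundedDensity p) (hab : LexPos a b) (hsc : LexPos s c) :
    ∃ l u w, IsStringSolution p l u w ∧ u 0 = a ∧ w 0 = b ∧ s * w 1 + c * u 1 = 0 ∧
      ∀ x ∈ Ioo (0 : ℝ) 1, 0 < u x := by
  obtain ⟨u, w, h⟩ := hp.exists_isInitialValueFamily a b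
  set l := sSup (positiveParameters u w s c)
  have hmem : l ∈ closure (positiveParameters u w s c) :=
    csSup_mem_closure (h.nonempty_positiveParameters hp hab hsc) (h.bddAbove_positiveParameters hp)
  obtain ⟨hnonneg, hbdry⟩ := h.nonneg_of_mem_closure hab.nonneg hmem
  have hsol := h.isStringSolution l
  have hne : ∃ x ∈ Icc (0 : ℝ) 1, u l x ≠ 0 := hsol.exists_ne_zero <| by
    rw [h.initial, h.initial_deriv]
    exact hab.imp ne_of_gt fun hb => hb.2.ne'
  have hpos : ∀ x ∈ Ioo (0 : ℝ) 1, 0 < u l x :=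
    fun x hx => hsol.pos_of_nonneg hp.toIsCoefficient hne hnonneg hx
  refine ⟨l, u l, w l, hsol, h.initial l, h.initial_deriv l,
    (hbdry.eq_of_not_lt fun hlt => ?_).symm, hpos⟩
  have hu1 : 0 < u l 1 := by
    refine (hnonneg 1 (right_mem_Icc.2 zero_le_one)).lt_of_ne' fun hu1 => ?_
    rw [hu1, mul_zero, add_zero] at hlt
    exact hlt.not_ge (mul_nonpos_of_nonneg_of_nonpos hsc.nonneg
      (hsol.deriv_one_nonpos_of_nonneg hnonneg hu1))
  refine h.sSup_positiveParameters_notMem hp hab ⟨fun x hx => ?_, hlt⟩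
  rcases hx.2.eq_or_lt with rfl | hx1
  · exact hu1
  · exact hpos x ⟨hx.1, hx1⟩

/-! ### Lowest eigenvalues -/

theorem wronskian_eq_zero_of_boundary {a b a' b' γ : ℝ}
    (h : a * Real.cos γ + b * Real.sin γ = 0) (h' : a' * Real.cos γ + b' * Real.sin γ = 0) :
    b' * a - a' * b = 0 := by
  linear_combination (-(b' * a - a' * b)) * Real.sin_sq_add_cos_sq γ +
    (b' * Real.cos γ - a' * Real.sin γ) * h + (a * Real.sin γ - b * Real.cos γ) * h'

/-- `u`, with derivative `w`, is a real eigenfunction of the string operator `S(p, α, β)` for the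
real eigenvalue `l`. -/
structure IsRealEigenfunction (p : ℝ → ℝ) (α β l : ℝ) (u w : ℝ → ℝ) : Prop
    extends IsStringSolution p l u w where
  boundary_zero : u 0 * Real.cos α + w 0 * Real.sin α = 0
  boundary_one : u 1 * Real.cos β + w 1 * Real.sin β = 0
  nonzero : ∃ x ∈ Icc (0 : ℝ) 1, u x ≠ 0

namespace IsRealEigenfunction

variable {p q : ℝ → ℝ} {α β l m : ℝ} {u w v z : ℝ → ℝ}

theorem isStringEigenvalue (h : IsRealEigenfunction p α β l u w) :
    IsStringEigenvalue p α β (l : ℂ) := by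
  refine ⟨fun x => (u x : ℂ), fun x => (w x : ℂ), fun x hx => (h.hasDeriv x hx).ofReal_comp,
    Complex.continuous_ofReal.comp_continuousOn h.continuousOn_deriv, fun x hx hcx => ?_,
    mod_cast h.boundary_zero, mod_cast h.boundary_one, mod_cast h.nonzero⟩
  exact (h.equation x hx hcx).ofReal_comp.congr_deriv (by push_cast; rfl)

theorem not_forall_lt (hu : IsRealEigenfunction p α β l u w)
    (hv : IsRealEigenfunction q α β m v z) (hp : IsCoefficient p)
    (hq : (interiorDiscontinuities q).Countable) (hpos : ∀ x ∈ Ioo (0 : ℝ) 1, 0 < u x) :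
    ¬ ∀ x ∈ Ioo (0 : ℝ) 1, m * q x < l * p x := by
  refine hu.not_forall_lt_of_pos hv.toIsStringSolution hp hq hpos hv.nonzero ?_ ?_
  · rw [wronskian_eq_zero_of_boundary hu.boundary_zero hv.boundary_zero, mul_zero]
  · rw [wronskian_eq_zero_of_boundary hu.boundary_one hv.boundary_one, mul_zero]

end IsRealEigenfunction

theorem map_boundary_eq_zero (φ : ℂ →L[ℝ] ℝ) {a b : ℂ} {c s : ℝ} (h : a * c + b * s = 0) :
    φ a * c + φ b * s = 0 := by
  have hmul (z : ℂ) (t : ℝ) : φ (z * t) = φ z * t := by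
    rw [mul_comm, ← Complex.real_smul, map_smul, smul_eq_mul, mul_comm]
  rw [← hmul, ← hmul, ← map_add, h, map_zero]

namespace IsEigenfunction

variable {p : ℝ → ℝ} {α β l : ℝ} {μ : ℂ} {u w : ℝ → ℂ}

theorem continuousOn (h : IsEigenfunction p α β μ u w) : ContinuousOn u (Icc 0 1) :=
  fun x hx => (h.hasDeriv x hx).continuousWithinAt

theorem hasDerivAt_wronskian (h : IsEigenfunction p α β μ u w) {x : ℝ} (hx : x ∈ Ioo (0 : ℝ) 1)
    (hpx : ContinuousAt p x) :
    HasDerivAt (fun x => (w x).re * (u x).im - (u x).re * (w x).im)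
      (μ.im * p x * Complex.normSq (u x)) x := by
  have hu := (h.hasDeriv x (Ioo_subset_Icc_self hx)).hasDerivAt (Icc_mem_nhds hx.1 hx.2)
  have hw := h.equation x hx hpx
  have map_re {f : ℝ → ℂ} {f' : ℂ} (hf : HasDerivAt f f' x) :
      HasDerivAt (fun x => (f x).re) f'.re x := Complex.reCLM.hasFDerivAt.comp_hasDerivAt x hf
  have map_im {f : ℝ → ℂ} {f' : ℂ} (hf : HasDerivAt f f' x) :
      HasDerivAt (fun x => (f x).im) f'.im x := Complex.imCLM.hasFDerivAt.comp_hasDerivAt x hf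
  refine (((map_re hw).mul (map_im hu)).sub ((map_re hu).mul (map_im hw))).congr_deriv ?_
  simp only [Complex.neg_re, Complex.neg_im, Complex.mul_re, Complex.mul_im, Complex.ofReal_re,
    Complex.ofReal_im, Complex.normSq_apply]
  ring

theorem im_eq_zero (h : IsEigenfunction p α β μ u w) (hp : IsBoundedDensity p) : μ.im = 0 := by
  by_contra him
  obtain ⟨x, hx, hxS, hux⟩ :=
    exists_ne_zero_off_countable zero_lt_one hp.countable h.continuousOn h.nonzero
  have hends {a b : ℂ} {γ : ℝ} (hab : a * (Real.cos γ : ℂ) + b * (Real.sin γ : ℂ) = 0) :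
      b.re * a.im - a.re * b.im = 0 := by
    have := wronskian_eq_zero_of_boundary (map_boundary_eq_zero Complex.imCLM hab)
      (map_boundary_eq_zero Complex.reCLM hab)
    simpa using this
  have hcont : ContinuousOn (fun x => (w x).re * (u x).im - (u x).re * (w x).im) (Icc 0 1) := by
    have hu := h.continuousOn
    have hw := h.continuousOn_deriv
    fun_prop
  have hderiv_zero : μ.im * (μ.im * p x * Complex.normSq (u x)) = 0 :=
    deriv_eq_zero_of_nonneg_of_endpoints_eq hp.countable (hcont.const_mul μ.im)
      (fun y hy hyS => (h.hasDerivAt_wronskian hy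
        (continuousAt_of_notMem_interiorDiscontinuities hy hyS)).const_mul μ.im)
      (fun y hy _ => by
        have := hp.pos (Ioo_subset_Icc_self hy)
        have := Complex.normSq_nonneg (u y)
        calc 0 ≤ μ.im ^ 2 * p y * Complex.normSq (u y) := by positivity
          _ = _ := by ring)
      (by simp only [hends h.boundary_zero, hends h.boundary_one]) hx hxS
  simp [him, hux, (hp.pos (Ioo_subset_Icc_self hx)).ne'] at hderiv_zero

theorem isRealEigenfunction_comp (h : IsEigenfunction p α β (l : ℂ) u w) (φ : ℂ →L[ℝ] ℝ)
    (hne : ∃ x ∈ Icc (0 : ℝ) 1, φ (u x) ≠ 0) :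
    IsRealEigenfunction p α β l (fun x => φ (u x)) (fun x => φ (w x)) where
  hasDeriv x hx := φ.hasFDerivAt.comp_hasDerivWithinAt x (h.hasDeriv x hx)
  continuousOn_deriv := φ.continuous.comp_continuousOn h.continuousOn_deriv
  equation x hx hpx := by
    refine (φ.hasFDerivAt.comp_hasDerivAt x (h.equation x hx hpx)).congr_deriv ?_
    rw [map_neg, ← Complex.ofReal_mul, ← Complex.real_smul, map_smul, smul_eq_mul]
  boundary_zero := map_boundary_eq_zero φ h.boundary_zero
  boundary_one := map_boundary_eq_zero φ h.boundary_one
  nonzero := hne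

theorem exists_isRealEigenfunction (h : IsEigenfunction p α β (l : ℂ) u w) :
    ∃ v z, IsRealEigenfunction p α β l v z := by
  obtain ⟨x, hx, hux⟩ := h.nonzero
  by_cases hre : (u x).re = 0
  · exact ⟨_, _, h.isRealEigenfunction_comp Complex.imCLM
      ⟨x, hx, fun him => hux (Complex.ext hre him)⟩⟩
  · exact ⟨_, _, h.isRealEigenfunction_comp Complex.reCLM ⟨x, hx, hre⟩⟩

end IsEigenfunction

theorem IsBoundedDensity.exists_pos_isRealEigenfunction {p : ℝ → ℝ} (hp : IsBoundedDensity p)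
    (α β : ℝ) :
    ∃ l u w, IsRealEigenfunction p α β l u w ∧ ∀ x ∈ Ioo (0 : ℝ) 1, 0 < u x := by
  have sin_or_cos (γ : ℝ) : Real.sin γ ≠ 0 ∨ Real.cos γ ≠ 0 :=
    not_and_or.1 fun h => by simpa [h.1, h.2] using Real.sin_sq_add_cos_sq γ
  obtain ⟨ε, -, hα⟩ := exists_lexPos_mul ((sin_or_cos α).imp_right neg_ne_zero.2)
  obtain ⟨δ, hδ, hβ⟩ := exists_lexPos_mul (sin_or_cos β)
  obtain ⟨l, u, w, hu, hu0, hw0, h1, hpos⟩ := hp.exists_pos_isStringSolution hα hβ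
  refine ⟨l, u, w, ⟨hu, ?_, mul_left_cancel₀ hδ ?_, 1 / 2, by norm_num, ?_⟩, hpos⟩
  · rw [hu0, hw0]
    ring
  · linear_combination h1
  · exact (hpos _ (by norm_num)).ne'

theorem IsRealEigenfunction.isLowestEigenvalue_of_pos {p : ℝ → ℝ} {α β l : ℝ} {u w : ℝ → ℝ}
    (h : IsRealEigenfunction p α β l u w) (hp : IsBoundedDensity p)
    (hpos : ∀ x ∈ Ioo (0 : ℝ) 1, 0 < u x) : IsLowestEigenvalue p α β l := by
  refine ⟨h.isStringEigenvalue, fun μ ⟨v, z, hv⟩ => ?_⟩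
  have him : μ.im = 0 := hv.im_eq_zero hp
  obtain ⟨m, rfl⟩ : ∃ m : ℝ, (m : ℂ) = μ := ⟨μ.re, Complex.ext rfl him.symm⟩
  obtain ⟨v', z', hv'⟩ := hv.exists_isRealEigenfunction
  refine ⟨him, le_of_not_gt fun hlt => ?_⟩
  exact h.not_forall_lt hv' hp.toIsCoefficient hp.countable hpos fun x hx =>
    mul_lt_mul_of_pos_right hlt (hp.pos (Ioo_subset_Icc_self hx))

theorem IsLowestEigenvalue.lowestEigenvalue_eq {p : ℝ → ℝ} {α β l : ℝ}
    (h : IsLowestEigenvalue p α β l) : lowestEigenvalue p α β = l :=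
  IsLeast.csInf_eq ⟨h.1, fun m hm => (h.2 m hm).2⟩

namespace IsBoundedDensity

variable {p q : ℝ → ℝ}

theorem exists_pos_isRealEigenfunction_lowestEigenvalue (hp : IsBoundedDensity p) (α β : ℝ) :
    ∃ u w, IsRealEigenfunction p α β (lowestEigenvalue p α β) u w ∧
      ∀ x ∈ Ioo (0 : ℝ) 1, 0 < u x := by
  obtain ⟨l, u, w, hu, hpos⟩ := hp.exists_pos_isRealEigenfunction α β
  rw [(hu.isLowestEigenvalue_of_pos hp hpos).lowestEigenvalue_eq]
  exact ⟨u, w, hu, hpos⟩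

theorem isLowestEigenvalue_lowestEigenvalue (hp : IsBoundedDensity p) (α β : ℝ) :
    IsLowestEigenvalue p α β (lowestEigenvalue p α β) := by
  obtain ⟨u, w, hu, hpos⟩ := hp.exists_pos_isRealEigenfunction_lowestEigenvalue α β
  exact hu.isLowestEigenvalue_of_pos hp hpos

theorem exists_lowestEigenvalue_mul_le (hp : IsBoundedDensity p) (hq : IsBoundedDensity q)
    (α β : ℝ) :
    ∃ x ∈ Icc (0 : ℝ) 1, lowestEigenvalue p α β * p x ≤ lowestEigenvalue q α β * q x := by
  obtain ⟨u, w, hu, hpos⟩ := hp.exists_pos_isRealEigenfunction_lowestEigenvalue α β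
  obtain ⟨v, z, hv, -⟩ := hq.exists_pos_isRealEigenfunction_lowestEigenvalue α β
  by_contra! hlt
  exact hu.not_forall_lt hv hp.toIsCoefficient hq.countable hpos fun x hx =>
    hlt x (Ioo_subset_Icc_self hx)

theorem exists_lowestEigenvalue_le_mul_div (hp : IsBoundedDensity p) (hq : IsBoundedDensity q)
    (α β : ℝ) :
    ∃ x ∈ Icc (0 : ℝ) 1, lowestEigenvalue p α β ≤ lowestEigenvalue q α β * (q x / p x) := by
  obtain ⟨x, hx, hle⟩ := hp.exists_lowestEigenvalue_mul_le hq α β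
  exact ⟨x, hx, by rwa [← mul_div_assoc, le_div_iff₀ (hp.pos hx)]⟩

theorem exists_mul_div_le_lowestEigenvalue (hp : IsBoundedDensity p) (hq : IsBoundedDensity q)
    (α β : ℝ) :
    ∃ x ∈ Icc (0 : ℝ) 1, lowestEigenvalue q α β * (q x / p x) ≤ lowestEigenvalue p α β := by
  obtain ⟨x, hx, hle⟩ := hq.exists_lowestEigenvalue_mul_le hp α β
  exact ⟨x, hx, by rwa [← mul_div_assoc, div_le_iff₀ (hp.pos hx)]⟩

theorem bddBelow_div (hp : IsBoundedDensity p) (hq : IsBoundedDensity q) :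
    BddBelow ((fun x => q x / p x) '' Icc 0 1) :=
  ⟨0, forall_mem_image.2 fun _ hx => (div_pos (hq.pos hx) (hp.pos hx)).le⟩

theorem bddAbove_div (hp : IsBoundedDensity p) (hq : IsBoundedDensity q) :
    BddAbove ((fun x => q x / p x) '' Icc 0 1) := by
  obtain ⟨c, hc, hcp⟩ := hp.bounded_away
  obtain ⟨B, hB⟩ := hq.bounded
  refine ⟨B / c, forall_mem_image.2 fun x hx => ?_⟩
  have hqB : q x ≤ B := (le_abs_self _).trans (hB x hx)
  exact div_le_div₀ ((hq.pos hx).le.trans hqB) hqB hc (hcp x hx)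

end IsBoundedDensity

theorem theorem3p2_general {p q : ℝ → ℝ} (hp : IsBoundedDensity p) (hq : IsBoundedDensity q)
    (α β : ℝ) :
    IsLowestEigenvalue p α β (lowestEigenvalue p α β) ∧
    IsLowestEigenvalue q α β (lowestEigenvalue q α β) ∧
    (0 ≤ lowestEigenvalue q α β →
      lowestEigenvalue q α β * sInf ((fun x => q x / p x) '' Icc 0 1) ≤ lowestEigenvalue p α β ∧
      lowestEigenvalue p α β ≤ lowestEigenvalue q α β * sSup ((fun x => q x / p x) '' Icc 0 1)) ∧
    (lowestEigenvalue q α β ≤ 0 →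
      lowestEigenvalue q α β * sSup ((fun x => q x / p x) '' Icc 0 1) ≤ lowestEigenvalue p α β ∧
      lowestEigenvalue p α β ≤
        lowestEigenvalue q α β * sInf ((fun x => q x / p x) '' Icc 0 1)) := by
  obtain ⟨x, hx, hle⟩ := hp.exists_mul_div_le_lowestEigenvalue hq α β
  obtain ⟨y, hy, hge⟩ := hp.exists_lowestEigenvalue_le_mul_div hq α β
  have inf_le {t : ℝ} (ht : t ∈ Icc (0 : ℝ) 1) :
      sInf ((fun x => q x / p x) '' Icc 0 1) ≤ q t / p t :=
    csInf_le (hp.bddBelow_div hq) (mem_image_of_mem _ ht)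
  have le_sup {t : ℝ} (ht : t ∈ Icc (0 : ℝ) 1) :
      q t / p t ≤ sSup ((fun x => q x / p x) '' Icc 0 1) :=
    le_csSup (hp.bddAbove_div hq) (mem_image_of_mem _ ht)
  exact ⟨hp.isLowestEigenvalue_lowestEigenvalue α β, hq.isLowestEigenvalue_lowestEigenvalue α β,
    fun h => ⟨(mul_le_mul_of_nonneg_left (inf_le hx) h).trans hle,
      hge.trans (mul_le_mul_of_nonneg_left (le_sup hy) h)⟩,
    fun h => ⟨(mul_le_mul_of_nonpos_left (le_sup hx) h).trans hle,
      hge.trans (mul_le_mul_of_nonpos_left (inf_le hy) h)⟩⟩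

theorem theorem3p2 (p : ℝ → ℝ) (hp : IsDensity p) (α β : ℝ)
    (hα : α ∈ Set.Ioc 0 Real.pi) (hβ : β ∈ Set.Ico 0 Real.pi) :
    IsLowestEigenvalue p α β (lowestEigenvalue p α β) ∧
    IsLowestEigenvalue (fun _ => 1) α β (lowestEigenvalue (fun _ => 1) α β) ∧
    (0 ≤ lowestEigenvalue (fun _ => 1) α β →
      lowestEigenvalue (fun _ => 1) α β * infInv p ≤ lowestEigenvalue p α β ∧
      lowestEigenvalue p α β ≤ lowestEigenvalue (fun _ => 1) α β * supInv p) ∧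
    (lowestEigenvalue (fun _ => 1) α β ≤ 0 →
      lowestEigenvalue (fun _ => 1) α β * supInv p ≤ lowestEigenvalue p α β ∧
      lowestEigenvalue p α β ≤ lowestEigenvalue (fun _ => 1) α β * infInv p) := by
  simpa only [infInv, supInv, one_div] using
    theorem3p2_general hp.isBoundedDensity isBoundedDensity_one α β
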